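/- A function $\varphi:[0,\infty)\to\mathbb R$ is called absolutely monotonic if it is infinitely often differentiable on $[0,\infty)$ and $\varphi^{(k)}(x)\ge 0$ for all $k\ge 0$ and $x\ge 0$. A function $g:(0,\infty)\to\mathbb R$ is called completely monotonic if it is infinitely often differentiable on $(0,\infty)$ and $(-1)^n g^{(n)}(x)\ge 0$ for all $n\ge 0$ and $x>0$; it is called completely monotonic of order $\alpha\ge 0$ if $x\mapsto x^{\alpha}g(x)$ is completely monotonic. Theorem. The following properties of a function $f:(0,\infty)\to\mathbb R$ are equivalent. (i) There is an absolutely monotonic function $\varphi:[0,\infty)\to\mathbb R$ such that, for all $x>0$, the following integral converges and $$f(x)=\int_0^\infty e^{-xt}\varphi(t)\,dt .$$ (ii) There is a sequence $\{a_k\}_{k\ge 1}$ with $a_k\ge 0$ for all $k$ such that for every $n\ge 0$ $$f(x)=\sum_{k=1}^{n}\frac{a_k}{x^k}+R_n(x),\qquad x>0,$$ where $R_n$ is a completely monotonic function of order $n$. (iii) For every $k\ge 0$, the function $x^kf(x)$ is $k$ times differentiable on $(0,\infty)$ and $(-1)^k\bigl(x^kf(x)\bigr)^{(k)}$ is completely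 monotonic. (iv) For every $k\ge 0$, the function $x^kf(x)$ is $k$ times differentiable on $(0,\infty)$ and $(-1)^k\bigl(x^kf(x)\bigr)^{(k)}\ge 0$ for all $x>0$. (v) $f(x)\ge 0$ for all $x>0$, and for every $k\ge 1$ the function $x^kf(x)$ is $2k-1$ times differentiable on $(0,\infty)$ and $\bigl(x^kf(x)\bigr)^{(2k-1)}\le 0$ for all $x>0$. -/

import Mathlib

open Set MeasureTheory
open scoped ContDiff

/-- `g` is `n` times differentiable on `s`: each of its derivatives of order `j < n` exists and is
differentiable on `s`. -/
def TimesDifferentiableOn (n : ℕ) (g : ℝ → ℝ) (s : Set ℝ) : Prop :=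
  ∀ j < n, DifferentiableOn ℝ (iteratedDerivWithin j g s) s

/-- `g` is completely monotonic on `(0, ∞)`: it is infinitely often differentiable there and
`(-1) ^ n * g⁽ⁿ⁾(x) ≥ 0` for all `n ≥ 0` and `x > 0`. -/
def CompletelyMonotonic (g : ℝ → ℝ) : Prop :=
  ContDiffOn ℝ ∞ g (Ioi 0) ∧
    ∀ n : ℕ, ∀ x > 0, 0 ≤ (-1) ^ n * iteratedDerivWithin n g (Ioi 0) x

/-- `g` is completely monotonic of order `α`: the function `x ^ α * g x` is completely monotonic
on `(0, ∞)`. Order `0` is plain complete monotonicity. -/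
def CompletelyMonotonicOfOrder (α : ℝ) (g : ℝ → ℝ) : Prop :=
  CompletelyMonotonic fun x => x ^ α * g x

/-- `f` is on `(0, ∞)` the Laplace transform of `φ`, the defining integral being convergent for
every `x > 0`. -/
def IsLaplaceTransform (f φ : ℝ → ℝ) : Prop :=
  ∀ x > 0, IntegrableOn (fun t => Real.exp (-x * t) * φ t) (Ioi 0) ∧
    f x = ∫ t in Ioi 0, Real.exp (-x * t) * φ t

section

open Filter Topology

/-! The conditions all describe f(x) = ∑ b_k / x^(k+1) with b_k ≥ 0, convergent for every x > 0
(`IsInvPowerSeries`). The engine is Bernstein's theorem on (0, ∞), `IsDerivSeq.exists_hasSum`.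

For (i), Bernstein expands φ = ∑ c_k t^k, and termwise integration gives b_k = k! c_k; dividing by
k! reverses this. Cutting the series after n terms gives (ii). From (ii), x^k f is a polynomial of
degree < k plus a completely monotonic function, so derivatives of order ≥ k see only the latter:
order k gives (iii), hence (iv), and the odd order 2k - 1 ≥ k gives (v).

From (iv), put y = 1/x: the k-th derivative of f(1/y)/y is y^(-k-1) (-1)^k (x^k f)^(k) at x = 1/y,
hence nonnegative, and Bernstein returns the series (`isInvPowerSeries_of_nonneg`).

From (v), k = 1 makes x f(x) decrease, so x^k f = O(x^(k-1)). This growth bound carries the sign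
condition from order 2k - 1 down to order k (`IsDerivSeq.nonneg_of_le_pow`), which is (iv). -/

/-! ### Sequences of successive derivatives -/

theorem eqOn_iteratedDerivWithin_of_hasDerivWithinAt {s : Set ℝ} (hs : UniqueDiffOn ℝ s)
    {D : ℕ → ℝ → ℝ} (hD : ∀ n, ∀ x ∈ s, HasDerivWithinAt (D n) (D (n + 1) x) s x) (n : ℕ) :
    EqOn (iteratedDerivWithin n (D 0) s) (D n) s := by
  induction n with
  | zero => intro x _; simp
  | succ n ih =>
    intro x hx
    rw [iteratedDerivWithin_succ, derivWithin_congr ih (ih hx)]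
    exact (hD n x hx).derivWithin (hs x hx)

theorem contDiffOn_of_hasDerivWithinAt {s : Set ℝ} (hs : UniqueDiffOn ℝ s)
    {D : ℕ → ℝ → ℝ} (hD : ∀ n, ∀ x ∈ s, HasDerivWithinAt (D n) (D (n + 1) x) s x) :
    ContDiffOn ℝ ∞ (D 0) s :=
  contDiffOn_of_differentiableOn_deriv (n := ⊤) fun m _ =>
    DifferentiableOn.congr (fun x hx => (hD m x hx).differentiableWithinAt)
      (eqOn_iteratedDerivWithin_of_hasDerivWithinAt hs hD m)

theorem ContDiffOn.hasDerivAt_iteratedDerivWithin {s : Set ℝ} (hs : IsOpen s) {h : ℝ → ℝ}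
    (hh : ContDiffOn ℝ ∞ h s) (n : ℕ) {x : ℝ} (hx : x ∈ s) :
    HasDerivAt (iteratedDerivWithin n h s) (iteratedDerivWithin (n + 1) h s x) x := by
  have h1 := hh.differentiableOn_iteratedDerivWithin (m := n)
    (by exact_mod_cast WithTop.coe_lt_top n) hs.uniqueDiffOn x hx
  have h2 := h1.hasDerivWithinAt.hasDerivAt (hs.mem_nhds hx)
  rwa [← iteratedDerivWithin_succ] at h2

/-- A sequence of functions on `(0, ∞)`, each the derivative of the previous one. -/
def IsDerivSeq (D : ℕ → ℝ → ℝ) : Prop :=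
  ∀ n, ∀ x > 0, HasDerivAt (D n) (D (n + 1) x) x

theorem ContDiffOn.isDerivSeq {h : ℝ → ℝ} (hh : ContDiffOn ℝ ∞ h (Ioi 0)) :
    IsDerivSeq fun n => iteratedDerivWithin n h (Ioi 0) :=
  fun n _ hx => hh.hasDerivAt_iteratedDerivWithin isOpen_Ioi n hx

namespace IsDerivSeq

variable {D : ℕ → ℝ → ℝ}

theorem eqOn (hD : IsDerivSeq D) (n : ℕ) :
    EqOn (iteratedDerivWithin n (D 0) (Ioi 0)) (D n) (Ioi 0) :=
  eqOn_iteratedDerivWithin_of_hasDerivWithinAt (uniqueDiffOn_Ioi 0)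
    (fun n x hx => (hD n x hx).hasDerivWithinAt) n

theorem contDiffOn (hD : IsDerivSeq D) : ContDiffOn ℝ ∞ (D 0) (Ioi 0) :=
  contDiffOn_of_hasDerivWithinAt (uniqueDiffOn_Ioi 0)
    (fun n x hx => (hD n x hx).hasDerivWithinAt)

theorem completelyMonotonic (hD : IsDerivSeq D) (h0 : ∀ n, ∀ x > 0, 0 ≤ (-1) ^ n * D n x) :
    CompletelyMonotonic (D 0) :=
  ⟨hD.contDiffOn, fun n x hx => by rw [hD.eqOn n hx]; exact h0 n x hx⟩

/-! ### Taylor's formula and Bernstein's theorem -/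

theorem taylor (hD : IsDerivSeq D) {a b : ℝ} (ha : 0 < a) (hab : a < b) (n : ℕ) :
    ∃ ξ ∈ Ioo a b, D 0 b = ∑ k ∈ Finset.range (n + 1), D k a / k.factorial * (b - a) ^ k +
      D (n + 1) ξ * (b - a) ^ (n + 1) / (n + 1).factorial := by
  have hu : UniqueDiffOn ℝ (Icc a b) := uniqueDiffOn_Icc hab
  have hd : ∀ n, ∀ x ∈ Icc a b, HasDerivWithinAt (D n) (D (n + 1) x) (Icc a b) x :=
    fun n x hx => (hD n x (ha.trans_le hx.1)).hasDerivWithinAt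
  have he := eqOn_iteratedDerivWithin_of_hasDerivWithinAt hu hd
  have hc := contDiffOn_of_hasDerivWithinAt hu hd
  have huI : uIcc a b = Icc a b := uIcc_of_le hab.le
  have huO : uIoo a b = Ioo a b := uIoo_of_le hab.le
  obtain ⟨ξ, hξ, h⟩ := taylor_mean_remainder_lagrange (f := D 0) (n := n) hab.ne
    (by rw [huI]; exact hc.of_le (by exact_mod_cast le_top))
    (by
      rw [huI, huO]
      exact (hc.differentiableOn_iteratedDerivWithin (m := n)
        (by exact_mod_cast WithTop.coe_lt_top n) hu).mono Ioo_subset_Icc_self)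
  rw [huO] at hξ
  rw [huI, he _ (Ioo_subset_Icc_self hξ), taylor_within_apply] at h
  refine ⟨ξ, hξ, ?_⟩
  rw [← h, eq_comm, add_eq_of_eq_sub']
  congr 1
  refine Finset.sum_congr rfl fun k _ => ?_
  rw [he _ (left_mem_Icc.2 hab.le), smul_eq_mul]
  ring

theorem monotoneOn (hD : IsDerivSeq D) (n : ℕ) (h0 : ∀ x > 0, 0 ≤ D (n + 1) x) :
    MonotoneOn (D n) (Ioi 0) :=
  monotoneOn_of_hasDerivWithinAt_nonneg (f' := D (n + 1)) (convex_Ioi 0)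
    (fun x hx => (hD n x hx).continuousAt.continuousWithinAt)
    (fun x hx => (hD n x (by simpa using hx)).hasDerivWithinAt)
    (fun x hx => h0 x (by simpa using hx))

theorem sum_le (hD : IsDerivSeq D) (h0 : ∀ n, ∀ x > 0, 0 ≤ D n x) {a b : ℝ} (ha : 0 < a)
    (hab : a < b) (n : ℕ) : ∑ k ∈ Finset.range (n + 1), D k a / k.factorial * (b - a) ^ k ≤ D 0 b := by
  obtain ⟨ξ, hξ, h⟩ := hD.taylor ha hab n
  have h1 := h0 (n + 1) ξ (ha.trans hξ.1)
  have h2 : 0 < b - a := sub_pos.2 hab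
  have : 0 ≤ D (n + 1) ξ * (b - a) ^ (n + 1) / (n + 1).factorial := by positivity
  linarith

/-- All derivatives increase, so the Lagrange remainder is at most the term of order n + 1 of the
expansion at b with step b - a. With step 2(b - a) that term is 2^(n+1) times larger, yet still at
most D 0 c; so the remainder tends to 0. -/
theorem hasSum (hD : IsDerivSeq D) (h0 : ∀ n, ∀ x > 0, 0 ≤ D n x) {a b : ℝ} (ha : 0 < a)
    (hab : a < b) : HasSum (fun k => D k a / k.factorial * (b - a) ^ k) (D 0 b) := by
  have hba : 0 < b - a := sub_pos.2 hab
  have hb : 0 < b := ha.trans hab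
  have hterm : ∀ x > 0, ∀ t > 0, ∀ k, 0 ≤ D k x / k.factorial * t ^ k := fun x hx t ht k => by
    have := h0 k x hx
    positivity
  rw [hasSum_iff_tendsto_nat_of_nonneg (hterm a ha _ hba), ← tendsto_add_atTop_iff_nat 1]
  set c : ℝ := b + 2 * (b - a)
  have hbc : b < c := by simp only [c]; linarith
  have hlow : ∀ n : ℕ, D 0 b - D 0 c * (1 / 2) ^ (n + 1) ≤
      ∑ k ∈ Finset.range (n + 1), D k a / k.factorial * (b - a) ^ k := fun n => by
    obtain ⟨ξ, hξ, h⟩ := hD.taylor ha hab n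
    have h1 : D (n + 1) ξ ≤ D (n + 1) b :=
      hD.monotoneOn (n + 1) (h0 _) (ha.trans hξ.1) hb hξ.2.le
    have h2 : D (n + 1) b / (n + 1).factorial * (c - b) ^ (n + 1) ≤ D 0 c :=
      (Finset.single_le_sum (f := fun k => D k b / k.factorial * (c - b) ^ k)
        (fun k _ => hterm b hb _ (sub_pos.2 hbc) k) (Finset.self_mem_range_succ (n + 1))).trans
        (hD.sum_le h0 hb hbc (n + 1))
    have h3 : D (n + 1) ξ * (b - a) ^ (n + 1) / (n + 1).factorial ≤
        D (n + 1) b * (b - a) ^ (n + 1) / (n + 1).factorial := by gcongr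
    have h4 : D (n + 1) b * (b - a) ^ (n + 1) / (n + 1).factorial =
        D (n + 1) b / (n + 1).factorial * (c - b) ^ (n + 1) * (1 / 2) ^ (n + 1) := by
      have : c - b = 2 * (b - a) := by simp only [c]; ring
      rw [mul_assoc, ← mul_pow, this]
      ring
    have h5 : D (n + 1) b / (n + 1).factorial * (c - b) ^ (n + 1) * (1 / 2) ^ (n + 1) ≤
        D 0 c * (1 / 2) ^ (n + 1) := by gcongr
    linarith
  refine tendsto_of_tendsto_of_tendsto_of_le_of_le (g := fun n : ℕ =>
    D 0 b - D 0 c * (1 / 2) ^ (n + 1)) ?_ tendsto_const_nhds hlow (hD.sum_le h0 ha hab)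
  have := (((tendsto_pow_atTop_nhds_zero_of_lt_one (r := (1 / 2 : ℝ)) (by norm_num)
    (by norm_num)).comp (tendsto_add_atTop_nat 1)).const_mul (D 0 c)).const_sub (D 0 b)
  simpa using this

/-- **Bernstein's theorem**: a function on `(0, ∞)` with nonnegative derivatives is the sum of an
everywhere convergent power series with nonnegative coefficients. -/
theorem exists_hasSum (hD : IsDerivSeq D) (h0 : ∀ n, ∀ x > 0, 0 ≤ D n x) :
    ∃ b : ℕ → ℝ, (∀ k, 0 ≤ b k) ∧ ∀ y > 0, HasSum (fun k => b k * y ^ k) (D 0 y) := by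
  -- Nothing is assumed at 0, so the expansion there is the limit of those at centres a n ↓ 0, whose
  -- coefficients decrease.
  set a : ℕ → ℝ := fun n => 1 / ((n : ℝ) + 1)
  have ha : ∀ n, 0 < a n := fun n => by positivity
  have ha1 : ∀ n, a n ≤ 1 := fun n => by
    simp only [a]
    rw [div_le_one (by positivity)]
    linarith [n.cast_nonneg (α := ℝ)]
  have hanti : Antitone a := fun m n h => one_div_le_one_div_of_le (by positivity) (by gcongr)
  have hnn : ∀ k n, 0 ≤ D k (a n) / k.factorial := fun k n => by
    have := h0 k _ (ha n)
    positivity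
  have hlim : ∀ k, Tendsto (fun n => D k (a n) / k.factorial) atTop
      (𝓝 (⨅ n, D k (a n) / k.factorial)) :=
    fun k => tendsto_atTop_ciInf
      (fun m n h => div_le_div_of_nonneg_right
        (hD.monotoneOn k (h0 _) (ha n) (ha m) (hanti h)) (by positivity))
      ⟨0, by rintro _ ⟨n, rfl⟩; exact hnn k n⟩
  have hle : ∀ k n, D k (a n) / k.factorial ≤ D k 1 / k.factorial := fun k n =>
    div_le_div_of_nonneg_right (hD.monotoneOn k (h0 _) (ha n) (mem_Ioi.2 one_pos) (ha1 n))
      (by positivity)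
  have hb : ∀ k, 0 ≤ ⨅ n, D k (a n) / k.factorial := fun k => ge_of_tendsto' (hlim k) (hnn k)
  refine ⟨fun k => ⨅ n, D k (a n) / k.factorial, hb, fun y hy => ?_⟩
  have hsum : Summable fun k => D k 1 / k.factorial * y ^ k := by
    simpa using (hD.hasSum h0 one_pos (lt_add_of_pos_right 1 hy)).summable
  have hy0 : ∀ k, 0 ≤ y ^ k := fun k => by positivity
  -- The coefficients at centre 1 dominate; their series at step y sums to D 0 (1 + y).
  have hT := tendsto_tsum_of_dominated_convergence (𝓕 := atTop)
    (f := fun n k => D k (a n) / k.factorial * y ^ k)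
    (g := fun k => (⨅ n, D k (a n) / k.factorial) * y ^ k) hsum
    (fun k => (hlim k).mul_const _)
    (Eventually.of_forall fun n k => by
      rw [Real.norm_of_nonneg (mul_nonneg (hnn k n) (hy0 k))]
      exact mul_le_mul_of_nonneg_right (hle k n) (hy0 k))
  have hS : ∀ n, ∑' k, D k (a n) / k.factorial * y ^ k = D 0 (a n + y) := fun n => by
    simpa using (hD.hasSum h0 (ha n) (lt_add_of_pos_right (a n) hy)).tsum_eq
  simp only [hS] at hT
  have hC : Tendsto (fun n => D 0 (a n + y)) atTop (𝓝 (D 0 y)) := by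
    refine (hD 0 y hy).continuousAt.tendsto.comp ?_
    simpa [a] using tendsto_one_div_add_atTop_nhds_zero_nat.add_const y
  rw [tendsto_nhds_unique hC hT]
  refine (Summable.of_nonneg_of_le (fun k => mul_nonneg (hb k) (hy0 k)) (fun k => ?_) hsum).hasSum
  exact mul_le_mul_of_nonneg_right (le_of_tendsto' (hlim k) (hle k)) (hy0 k)

end IsDerivSeq

/-! ### Entire power series with nonnegative coefficients -/

/-- The sum of the power series with coefficients `c`. -/
noncomputable def powerSum (c : ℕ → ℝ) (y : ℝ) : ℝ := ∑' k, c k * y ^ k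

/-- The coefficients `c` are nonnegative and their power series converges everywhere. -/
def IsEntireNonneg (c : ℕ → ℝ) : Prop :=
  (∀ k, 0 ≤ c k) ∧ ∀ y > 0, Summable fun k => c k * y ^ k

/-- The coefficients of the derivative of a power series. -/
def derivCoeff (c : ℕ → ℝ) (k : ℕ) : ℝ := (k + 1) * c (k + 1)

/-- The coefficients of `y` times a power series. -/
def shiftCoeff (c : ℕ → ℝ) : ℕ → ℝ
  | 0 => 0
  | k + 1 => c k

namespace IsEntireNonneg

variable {c : ℕ → ℝ}

theorem summable (hc : IsEntireNonneg c) (y : ℝ) : Summable fun k => c k * y ^ k := by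
  refine Summable.of_norm_bounded (hc.2 (|y| + 1) (by positivity)) fun k => ?_
  rw [norm_mul, norm_pow, Real.norm_of_nonneg (hc.1 k), Real.norm_eq_abs]
  have := hc.1 k
  gcongr
  linarith

theorem powerSum_nonneg (hc : IsEntireNonneg c) {y : ℝ} (hy : 0 ≤ y) : 0 ≤ powerSum c y :=
  tsum_nonneg fun k => mul_nonneg (hc.1 k) (pow_nonneg hy k)

theorem derivCoeff_mul_pow_le (hc : IsEntireNonneg c) {r : ℝ} (hr : 0 ≤ r) (k : ℕ) :
    derivCoeff c k * r ^ k ≤ c (k + 1) * (r + 1) ^ (k + 1) := by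
  -- The left side is one term of the binomial expansion of the right.
  have h : (k + 1) * r ^ k ≤ (r + 1) ^ (k + 1) := by
    rw [add_pow]
    refine le_trans (le_of_eq ?_) (Finset.single_le_sum
      (f := fun m => r ^ m * 1 ^ (k + 1 - m) * ((k + 1).choose m : ℝ))
      (fun m _ => by positivity) (Finset.mem_range.2 (show k < k + 1 + 1 by omega)))
    simp [mul_comm]
  calc derivCoeff c k * r ^ k = c (k + 1) * ((k + 1) * r ^ k) := by rw [derivCoeff]; ring
    _ ≤ _ := mul_le_mul_of_nonneg_left h (hc.1 _)

theorem summable_add (hc : IsEntireNonneg c) (n : ℕ) (y : ℝ) :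
    Summable fun k => c (k + n) * y ^ (k + n) :=
  (summable_nat_add_iff (f := fun k => c k * y ^ k) n).2 (hc.summable y)

theorem deriv (hc : IsEntireNonneg c) : IsEntireNonneg (derivCoeff c) := by
  have h0 : ∀ k, 0 ≤ derivCoeff c k := fun k => by
    have := hc.1 (k + 1)
    unfold derivCoeff
    positivity
  refine ⟨h0, fun y hy => ?_⟩
  exact Summable.of_nonneg_of_le (fun k => mul_nonneg (h0 k) (by positivity))
    (hc.derivCoeff_mul_pow_le hy.le) (hc.summable_add 1 (y + 1))

theorem hasDerivAt (hc : IsEntireNonneg c) (y : ℝ) :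
    HasDerivAt (powerSum c) (powerSum (derivCoeff c) y) y := by
  set r : ℝ := |y| + 1
  have hr : 0 ≤ r := by positivity
  have hu : Summable fun k => k * c k * r ^ (k - 1) := by
    rw [← summable_nat_add_iff 1]
    refine (hc.deriv.summable r).congr fun k => ?_
    simp [derivCoeff]
  have h := hasDerivAt_tsum_of_isPreconnected (t := Metric.ball (0 : ℝ) r)
    (g := fun k y => c k * y ^ k) (g' := fun k y => c k * (k * y ^ (k - 1))) (y₀ := 0) (y := y)
    hu Metric.isOpen_ball (convex_ball 0 r).isPreconnected
    (fun k z _ => (hasDerivAt_pow k z).const_mul (c k))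
    (fun k z hz => by
      have hz' : |z| ≤ r := by simpa using (mem_ball_zero_iff.1 hz).le
      have := hc.1 k
      rw [norm_mul, norm_mul, norm_pow, Real.norm_of_nonneg this, Real.norm_eq_abs,
        Real.norm_eq_abs, Nat.abs_cast, ← mul_assoc, mul_comm (c k)]
      gcongr)
    (Metric.mem_ball_self (by positivity)) (hc.summable 0)
    (by simp [r])
  have hs : Summable fun k => c k * (k * y ^ (k - 1)) := by
    rw [← summable_nat_add_iff 1]
    refine (hc.deriv.summable y).congr fun k => ?_
    simp only [derivCoeff, Nat.add_sub_cancel, Nat.cast_add, Nat.cast_one]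
    ring
  refine h.congr_deriv ?_
  rw [hs.tsum_eq_zero_add, powerSum]
  simp only [Nat.cast_zero, zero_mul, mul_zero, zero_add]
  refine tsum_congr fun k => ?_
  simp only [derivCoeff, Nat.add_sub_cancel, Nat.cast_add, Nat.cast_one]
  ring

theorem add_right (hc : IsEntireNonneg c) (n : ℕ) : IsEntireNonneg fun k => c (k + n) := by
  refine ⟨fun k => hc.1 _, fun y hy => ?_⟩
  refine ((hc.summable_add n y).mul_right (y ^ n)⁻¹).congr fun k => ?_
  rw [pow_add]
  field_simp

theorem powerSum_eq_add (hc : IsEntireNonneg c) (y : ℝ) :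
    powerSum c y = c 0 + y * powerSum (fun k => c (k + 1)) y := by
  rw [powerSum, (hc.summable y).tsum_eq_zero_add, powerSum, ← tsum_mul_left]
  simp only [pow_zero, mul_one]
  congr 1
  exact tsum_congr fun k => by ring

theorem shift (hc : IsEntireNonneg c) : IsEntireNonneg (shiftCoeff c) := by
  refine ⟨fun k => ?_, fun y hy => ?_⟩
  · cases k with
    | zero => exact le_rfl
    | succ k => exact hc.1 k
  · rw [← summable_nat_add_iff 1]
    refine ((hc.summable y).mul_right y).congr fun k => ?_
    simp only [shiftCoeff]
    ring

theorem powerSum_shiftCoeff (hc : IsEntireNonneg c) (y : ℝ) :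
    powerSum (shiftCoeff c) y = y * powerSum c y := by
  rw [hc.shift.powerSum_eq_add]
  simp [shiftCoeff]

theorem iterate {T : (ℕ → ℝ) → ℕ → ℝ} (hT : ∀ c, IsEntireNonneg c → IsEntireNonneg (T c))
    (hc : IsEntireNonneg c) (n : ℕ) : IsEntireNonneg (T^[n] c) := by
  induction n with
  | zero => exact hc
  | succ n ih => rw [Function.iterate_succ_apply']; exact hT _ ih

theorem hasDerivAt_comp_inv (hc : IsEntireNonneg c) {x : ℝ} (hx : 0 < x) :
    HasDerivAt (fun x => powerSum c x⁻¹)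
      (-powerSum (shiftCoeff (shiftCoeff (derivCoeff c))) x⁻¹) x := by
  refine ((hc.hasDerivAt x⁻¹).comp x (hasDerivAt_inv hx.ne')).congr_deriv ?_
  rw [hc.deriv.shift.powerSum_shiftCoeff, hc.deriv.powerSum_shiftCoeff]
  field_simp

/-- Differentiating P(1/x) gives -x⁻² P'(1/x), minus a series of the same kind in 1/x, so the signs
alternate forever. -/
theorem completelyMonotonic_inv (hc : IsEntireNonneg c) :
    CompletelyMonotonic fun x => powerSum c x⁻¹ := by
  set T : (ℕ → ℝ) → ℕ → ℝ := fun c => shiftCoeff (shiftCoeff (derivCoeff c))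
  have hT : ∀ n, IsEntireNonneg (T^[n] c) :=
    hc.iterate fun c hc => hc.deriv.shift.shift
  have hD : IsDerivSeq fun n x => (-1) ^ n * powerSum (T^[n] c) x⁻¹ := fun n x hx => by
    refine (((hT n).hasDerivAt_comp_inv hx).const_mul ((-1) ^ n)).congr_deriv ?_
    beta_reduce
    rw [Function.iterate_succ_apply', pow_succ]
    simp only [T]
    ring
  simpa using hD.completelyMonotonic fun n x hx => by
    rw [← mul_assoc, ← mul_pow]
    simpa using (hT n).powerSum_nonneg (inv_nonneg.2 hx.le)

theorem absolutelyMonotoneOn (hc : IsEntireNonneg c) :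
    AbsolutelyMonotoneOn (powerSum c) (Ici 0) := by
  have hT : ∀ n, IsEntireNonneg (derivCoeff^[n] c) := hc.iterate fun c hc => hc.deriv
  have hd : ∀ n, ∀ x ∈ univ, HasDerivWithinAt (powerSum (derivCoeff^[n] c))
      (powerSum (derivCoeff^[n + 1] c) x) univ x := fun n x _ => by
    rw [Function.iterate_succ_apply']
    exact ((hT n).hasDerivAt x).hasDerivWithinAt
  have h1 := contDiffOn_of_hasDerivWithinAt (D := fun n => powerSum (derivCoeff^[n] c))
    uniqueDiffOn_univ hd
  have h2 := eqOn_iteratedDerivWithin_of_hasDerivWithinAt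
    (D := fun n => powerSum (derivCoeff^[n] c)) uniqueDiffOn_univ hd
  refine .of_contDiff (contDiffOn_univ.1 h1) fun n x hx => ?_
  rw [← iteratedDerivWithin_univ]
  exact (h2 n (mem_univ x)).symm ▸ (hT n).powerSum_nonneg hx

end IsEntireNonneg

/-! ### Laplace integrals and termwise integration -/

theorem integrableOn_exp_mul_pow {x : ℝ} (hx : 0 < x) (c : ℝ) (k : ℕ) :
    IntegrableOn (fun t => Real.exp (-x * t) * (c * t ^ k)) (Ioi 0) := by
  have h := integrableOn_rpow_mul_exp_neg_mul_rpow (s := k) (p := 1) (b := x)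
    (by linarith [k.cast_nonneg (α := ℝ)]) one_pos hx
  refine IntegrableOn.congr_fun (Integrable.const_mul h c) (fun t _ => ?_) measurableSet_Ioi
  simp only [Real.rpow_natCast, Real.rpow_one]
  ring

theorem integral_exp_mul_pow {x : ℝ} (hx : 0 < x) (c : ℝ) (k : ℕ) :
    ∫ t in Ioi 0, Real.exp (-x * t) * (c * t ^ k) = c * k.factorial * x⁻¹ ^ (k + 1) := by
  have h := Real.integral_rpow_mul_exp_neg_mul_Ioi (a := k + 1) (by positivity) hx
  rw [Real.Gamma_nat_eq_factorial, add_sub_cancel_right] at h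
  rw [show c * k.factorial * x⁻¹ ^ (k + 1) = c * ((1 / x) ^ ((k : ℝ) + 1) * k.factorial) by
    rw [one_div, ← Nat.cast_add_one, Real.rpow_natCast]; ring, ← h, ← integral_const_mul]
  refine setIntegral_congr_fun measurableSet_Ioi fun t _ => ?_
  simp only [Real.rpow_natCast, neg_mul]
  ring

theorem integrable_tsum_of_summable_integral_norm {α : Type*} [MeasurableSpace α] {μ : Measure α}
    {F : ℕ → α → ℝ} (hF : ∀ k, Integrable (F k) μ) (hS : Summable fun k => ∫ a, ‖F k a‖ ∂μ)
    (hm : AEStronglyMeasurable (fun a => ∑' k, F k a) μ) :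
    Integrable (fun a => ∑' k, F k a) μ := by
  refine ⟨hm, ?_⟩
  calc ∫⁻ a, ‖∑' k, F k a‖ₑ ∂μ ≤ ∫⁻ a, ∑' k, ‖F k a‖ₑ ∂μ :=
        lintegral_mono fun a => enorm_tsum_le_tsum_enorm
    _ = ∑' k, ENNReal.ofReal (∫ a, ‖F k a‖ ∂μ) := by
        rw [lintegral_tsum fun k => (hF k).1.enorm]
        exact tsum_congr fun k => (ofReal_integral_norm_eq_lintegral_enorm (hF k)).symm
    _ < ⊤ := by
        rw [← ENNReal.ofReal_tsum_of_nonneg (fun k => integral_nonneg fun a => norm_nonneg _) hS]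
        exact ENNReal.ofReal_lt_top

/-! ### Smoothness, products with powers, and removal of polynomials -/

theorem TimesDifferentiableOn.mono {m n : ℕ} {g : ℝ → ℝ} {s : Set ℝ}
    (h : TimesDifferentiableOn n g s) (hmn : m ≤ n) : TimesDifferentiableOn m g s :=
  fun j hj => h j (hj.trans_le hmn)

theorem ContDiffOn.timesDifferentiableOn {g : ℝ → ℝ} {s : Set ℝ} (hs : UniqueDiffOn ℝ s)
    (h : ContDiffOn ℝ ∞ g s) (n : ℕ) : TimesDifferentiableOn n g s :=
  fun j _ => h.differentiableOn_iteratedDerivWithin (m := j)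
    (by exact_mod_cast WithTop.coe_lt_top j) hs

theorem contDiffOn_of_timesDifferentiableOn_pow_mul {f : ℝ → ℝ}
    (h : ∀ k : ℕ, TimesDifferentiableOn k (fun x => x ^ k * f x) (Ioi 0)) :
    ContDiffOn ℝ ∞ f (Ioi 0) := by
  refine contDiffOn_infty.2 fun n => ?_
  -- Being n + 1 times differentiable yields continuity of the n-th derivative, hence the exponent n
  -- + 1.
  have h1 : ContDiffOn ℝ n (fun x => x ^ (n + 1) * f x) (Ioi 0) :=
    contDiffOn_of_differentiableOn_deriv (n := n) fun m hm =>
      h (n + 1) m (by have := Nat.cast_le.1 hm; omega)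
  have h2 : ContDiffOn ℝ n (fun x : ℝ => (x ^ (n + 1))⁻¹) (Ioi 0) :=
    (contDiff_id.pow (n + 1)).contDiffOn.inv fun x hx => pow_ne_zero _ (ne_of_gt hx)
  refine (h2.mul h1).congr fun x hx => ?_
  have : x ≠ 0 := ne_of_gt hx
  field_simp

theorem iteratedDerivWithin_succ_id_mul {F : ℝ → ℝ} (hF : ContDiffOn ℝ ∞ F (Ioi 0)) (n : ℕ)
    {x : ℝ} (hx : 0 < x) :
    iteratedDerivWithin (n + 1) (fun x => x * F x) (Ioi 0) x =
      x * iteratedDerivWithin (n + 1) F (Ioi 0) x + (n + 1) * iteratedDerivWithin n F (Ioi 0) x := by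
  -- Leibniz's rule; at n = 0 the truncated index n - 1 is harmless, its factor n being 0.
  have hD : IsDerivSeq fun n x => x * iteratedDerivWithin n F (Ioi 0) x +
      n * iteratedDerivWithin (n - 1) F (Ioi 0) x := fun n x hx => by
    refine (((hasDerivAt_id x).mul (hF.isDerivSeq n x hx)).add
      ((hF.isDerivSeq (n - 1) x hx).const_mul (n : ℝ))).congr_deriv ?_
    cases n with
    | zero => simp; ring
    | succ n => simp; ring
  simpa using hD.eqOn (n + 1) hx

theorem CompletelyMonotonic.congr {g h : ℝ → ℝ} (hg : CompletelyMonotonic g)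
    (he : EqOn h g (Ioi 0)) : CompletelyMonotonic h :=
  ⟨hg.1.congr he, fun n x hx => by rw [iteratedDerivWithin_congr he hx]; exact hg.2 n x hx⟩

theorem CompletelyMonotonic.iteratedDerivWithin {g : ℝ → ℝ} (hg : CompletelyMonotonic g) (k : ℕ) :
    CompletelyMonotonic fun x => (-1) ^ k * iteratedDerivWithin k g (Ioi 0) x := by
  have hD : IsDerivSeq fun n x => (-1) ^ k * _root_.iteratedDerivWithin (k + n) g (Ioi 0) x :=
    fun n x hx => (hg.1.isDerivSeq (k + n) x hx).const_mul _
  refine hD.completelyMonotonic fun n x hx => ?_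
  rw [← mul_assoc, ← pow_add, add_comm n]
  exact hg.2 (k + n) x hx

theorem Polynomial.isDerivSeq_eval (p : Polynomial ℝ) :
    IsDerivSeq fun n x => (Polynomial.derivative^[n] p).eval x := fun n x _ => by
  simp only [Function.iterate_succ_apply']
  exact Polynomial.hasDerivAt _ x

theorem iteratedDerivWithin_polynomial_add {F G : ℝ → ℝ} {p : Polynomial ℝ} {k n : ℕ}
    (hp : p.degree < k) (hkn : k ≤ n) (hG : ContDiffOn ℝ ∞ G (Ioi 0))
    (hF : ∀ x > 0, F x = p.eval x + G x) :
    EqOn (iteratedDerivWithin n F (Ioi 0)) (iteratedDerivWithin n G (Ioi 0)) (Ioi 0) := by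
  have hD : IsDerivSeq fun n x => (Polynomial.derivative^[n] p).eval x +
      iteratedDerivWithin n G (Ioi 0) x :=
    fun n x hx => (p.isDerivSeq_eval n x hx).add (hG.isDerivSeq n x hx)
  intro x hx
  rw [iteratedDerivWithin_congr (s := Ioi 0) (g := fun x => p.eval x + G x) hF hx]
  have h := hD.eqOn n hx
  beta_reduce at h
  rw [Polynomial.iterate_derivative_eq_zero_of_degree_lt
    (hp.trans_le (Nat.cast_le.2 hkn)), Polynomial.eval_zero, zero_add] at h
  exact h

theorem exists_polynomial_of_expansion {f R : ℝ → ℝ} {a : ℕ → ℝ} {k : ℕ}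
    (h : ∀ x > 0, f x = (∑ j ∈ Finset.Icc 1 k, a j / x ^ j) + R x) :
    ∃ p : Polynomial ℝ, p.degree < k ∧ ∀ x > 0, x ^ k * f x = p.eval x + x ^ k * R x := by
  refine ⟨∑ j ∈ Finset.Icc 1 k, Polynomial.C (a j) * Polynomial.X ^ (k - j), ?_, fun x hx => ?_⟩
  · refine (Polynomial.degree_sum_le _ _).trans_lt ((Finset.sup_lt_iff ?_).2 fun j hj => ?_)
    · exact WithBot.bot_lt_coe k
    · refine (Polynomial.degree_C_mul_X_pow_le _ _).trans_lt ?_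
      have := Finset.mem_Icc.1 hj
      exact_mod_cast (show k - j < k by omega)
  · rw [h x hx, mul_add, Finset.mul_sum, Polynomial.eval_finsetSum]
    congr 1
    refine Finset.sum_congr rfl fun j hj => ?_
    rw [Polynomial.eval_mul, Polynomial.eval_C, Polynomial.eval_pow, Polynomial.eval_X,
      ← Nat.sub_add_cancel (Finset.mem_Icc.1 hj).2, pow_add, Nat.add_sub_cancel]
    field_simp

/-- G is x^k R_k. One G serves all orders n ≥ k, as (iii) needs n = k and (v) needs n = 2k - 1. -/
theorem iteratedDerivWithin_pow_mul_of_expansion {f : ℝ → ℝ} {a : ℕ → ℝ}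
    (h : ∀ n : ℕ, ∃ R : ℝ → ℝ, CompletelyMonotonicOfOrder n R ∧
      ∀ x > 0, f x = (∑ k ∈ Finset.Icc 1 n, a k / x ^ k) + R x) (k : ℕ) :
    ContDiffOn ℝ ∞ (fun x => x ^ k * f x) (Ioi 0) ∧
      ∃ G : ℝ → ℝ, CompletelyMonotonic G ∧ ∀ n, k ≤ n →
        EqOn (iteratedDerivWithin n (fun x => x ^ k * f x) (Ioi 0))
          (iteratedDerivWithin n G (Ioi 0)) (Ioi 0) := by
  obtain ⟨R, hR, hf⟩ := h k
  obtain ⟨p, hp, hpf⟩ := exists_polynomial_of_expansion hf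
  have hG : CompletelyMonotonic fun x => x ^ k * R x := by
    simpa [CompletelyMonotonicOfOrder] using hR
  exact ⟨((p.contDiff_aeval ∞).contDiffOn.add hG.1).congr hpf, _, hG,
    fun n hn => iteratedDerivWithin_polynomial_add hp hn hG.1 hpf⟩

/-! ### Lowering the order of a sign condition by growth -/

/-- If `D 0` grows slower than `x ^ n` and `(-1) ^ n * D n` decreases, then the latter is
nonnegative. -/
theorem IsDerivSeq.nonneg_of_le_pow {D : ℕ → ℝ → ℝ} (hD : IsDerivSeq D) {C : ℝ} {m n : ℕ}
    (hmn : m ≤ n) (hC : ∀ x ≥ 1, |D 0 x| ≤ C * x ^ m)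
    (h : ∀ x > 0, 0 ≤ (-1) ^ (n + 2) * D (n + 2) x) :
    ∀ x > 0, 0 ≤ (-1) ^ (n + 1) * D (n + 1) x := by
  intro a ha
  by_contra! hneg
  set c : ℝ := -((-1) ^ (n + 1) * D (n + 1) a) with hc
  have hc0 : 0 < c := neg_pos.2 hneg
  have hanti : AntitoneOn (fun x => (-1) ^ (n + 1) * D (n + 1) x) (Ioi 0) :=
    antitoneOn_of_hasDerivWithinAt_nonpos (f' := fun x => (-1) ^ (n + 1) * D (n + 2) x)
      (convex_Ioi 0)
      (fun x hx => ((hD (n + 1) x hx).const_mul _).continuousAt.continuousWithinAt)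
      (fun x hx => ((hD (n + 1) x (by simpa using hx)).const_mul _).hasDerivWithinAt)
      (fun x hx => by
        have := h x (by simpa using hx)
        rw [pow_succ] at this
        linarith)
  set S : ℝ := ∑ k ∈ Finset.range (n + 1), |D k a| / k.factorial
  have hS : 0 ≤ S := Finset.sum_nonneg fun k _ => by positivity
  -- K t^n will bound |D 0 (a + t)| plus the Taylor polynomial at a, while the remainder is at least
  -- c t^(n+1) / (n+1)!. The t below is large enough to contradict this, with t ≥ 1 and a + t ≤ 2t.
  set K : ℝ := |C| * 2 ^ n + S
  have hK : 0 ≤ K := by positivity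
  set t : ℝ := 1 + a + K * (n + 1).factorial / c with ht
  have hq : 0 ≤ K * (n + 1).factorial / c := by positivity
  have ht1 : 1 ≤ t := by linarith
  have hta : a ≤ t := by linarith
  have ht0 : 0 < t := by linarith
  obtain ⟨ξ, hξ, hT⟩ := hD.taylor ha (lt_add_of_pos_right a ht0) n
  rw [add_sub_cancel_left] at hT
  have h1 : c ≤ |D (n + 1) ξ| := by
    have h2 := hanti ha (ha.trans hξ.1) hξ.1.le
    have h3 := neg_abs_le ((-1) ^ (n + 1) * D (n + 1) ξ)
    rw [abs_mul, abs_pow, abs_neg, abs_one, one_pow, one_mul] at h3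
    simp only at h2
    linarith
  have h4 : |D 0 (a + t)| ≤ |C| * 2 ^ n * t ^ n := by
    calc |D 0 (a + t)| ≤ C * (a + t) ^ m := hC _ (by linarith)
      _ ≤ |C| * (a + t) ^ m := by gcongr; exact le_abs_self C
      _ ≤ |C| * (a + t) ^ n := by gcongr; linarith
      _ ≤ |C| * (2 * t) ^ n := by gcongr; linarith
      _ = _ := by rw [mul_pow, mul_assoc]
  have h5 : |∑ k ∈ Finset.range (n + 1), D k a / k.factorial * t ^ k| ≤ S * t ^ n := by
    refine (Finset.abs_sum_le_sum_abs _ _).trans ?_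
    rw [Finset.sum_mul]
    refine Finset.sum_le_sum fun k hk => ?_
    rw [abs_mul, abs_div, abs_pow, Nat.abs_cast, abs_of_pos ht0]
    have := Finset.mem_range_succ_iff.1 hk
    gcongr
  have h6 : c * t ^ (n + 1) / (n + 1).factorial ≤ K * t ^ n := by
    calc c * t ^ (n + 1) / (n + 1).factorial ≤
          |D (n + 1) ξ| * t ^ (n + 1) / (n + 1).factorial := by gcongr
      _ = |D (n + 1) ξ * t ^ (n + 1) / (n + 1).factorial| := by
        rw [abs_div, abs_mul, abs_pow, abs_of_pos ht0, Nat.abs_cast]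
      _ = |D 0 (a + t) - ∑ k ∈ Finset.range (n + 1), D k a / k.factorial * t ^ k| := by
        rw [hT, add_sub_cancel_left]
      _ ≤ |D 0 (a + t)| + |∑ k ∈ Finset.range (n + 1), D k a / k.factorial * t ^ k| := abs_sub _ _
      _ ≤ K * t ^ n := by linarith
  have h7 : c * t / (n + 1).factorial ≤ K := by
    refine le_of_mul_le_mul_right (le_trans (le_of_eq ?_) h6) (pow_pos ht0 n)
    ring
  rw [div_le_iff₀ (by positivity), ht, mul_add, mul_div_cancel₀ _ hc0.ne'] at h7
  have : 0 < c * (1 + a) := by positivity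
  linarith

/-! ### Inverse power series and the implications -/

/-- An everywhere convergent power series in `1 / x`, nonnegative coefficients, no constant term. -/
def IsInvPowerSeries (f : ℝ → ℝ) : Prop :=
  ∃ b : ℕ → ℝ, IsEntireNonneg b ∧ ∀ x > 0, f x = x⁻¹ * powerSum b x⁻¹

theorem IsInvPowerSeries.exists_isLaplaceTransform {f : ℝ → ℝ} (hf : IsInvPowerSeries f) :
    ∃ φ : ℝ → ℝ, AbsolutelyMonotoneOn φ (Ici 0) ∧ IsLaplaceTransform f φ := by
  obtain ⟨b, hb, hfb⟩ := hf
  have hc : IsEntireNonneg fun k => b k / k.factorial := by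
    have h0 : ∀ k, 0 ≤ b k / k.factorial := fun k => div_nonneg (hb.1 k) (by positivity)
    refine ⟨h0, fun y hy => ?_⟩
    refine Summable.of_nonneg_of_le (fun k => mul_nonneg (h0 k) (by positivity)) (fun k => ?_)
      (hb.2 y hy)
    have := div_le_self (hb.1 k) (Nat.one_le_cast.2 k.factorial_pos)
    gcongr
  refine ⟨_, hc.absolutelyMonotoneOn, fun x hx => ?_⟩
  set F : ℕ → ℝ → ℝ := fun k t => Real.exp (-x * t) * (b k / k.factorial * t ^ k)
  have hF : ∀ k, IntegrableOn (F k) (Ioi 0) := fun k => integrableOn_exp_mul_pow hx _ k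
  have hI : ∀ k, ∫ t in Ioi 0, F k t = x⁻¹ * (b k * x⁻¹ ^ k) := fun k => by
    rw [integral_exp_mul_pow hx, div_mul_cancel₀ _ (by positivity)]
    ring
  have hN : ∀ k, ∫ t in Ioi 0, ‖F k t‖ = x⁻¹ * (b k * x⁻¹ ^ k) := fun k => by
    rw [← hI]
    refine setIntegral_congr_fun measurableSet_Ioi fun t ht => Real.norm_of_nonneg ?_
    exact mul_nonneg (Real.exp_pos _).le (mul_nonneg (hc.1 k) (pow_nonneg (le_of_lt ht) k))
  have hS : Summable fun k => ∫ t in Ioi 0, ‖F k t‖ := by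
    simp only [hN]
    exact (hb.summable x⁻¹).mul_left _
  have hsum : ∀ t, ∑' k, F k t = Real.exp (-x * t) * powerSum (fun k => b k / k.factorial) t :=
    fun t => tsum_mul_left
  have hcont : Continuous (powerSum fun k => b k / k.factorial) :=
    continuous_iff_continuousAt.2 fun t => (hc.hasDerivAt t).continuousAt
  have hint := integrable_tsum_of_summable_integral_norm hF hS (by
    simp only [hsum]
    exact Continuous.aestronglyMeasurable (by fun_prop))
  have hval := (hasSum_integral_of_summable_integral_norm hF hS).tsum_eq
  simp only [hsum] at hint hval
  refine ⟨hint, ?_⟩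
  rw [← hval, hfb x hx, powerSum, ← tsum_mul_left]
  exact tsum_congr fun k => (hI k).symm

theorem IsLaplaceTransform.isInvPowerSeries {f φ : ℝ → ℝ} (hφ : AbsolutelyMonotoneOn φ (Ici 0))
    (hf : IsLaplaceTransform f φ) : IsInvPowerSeries f := by
  have hd : ContDiffOn ℝ ∞ φ (Ioi 0) := hφ.contDiffOn.mono Ioi_subset_Ici_self
  have hnn : ∀ n, ∀ x > 0, 0 ≤ iteratedDerivWithin n φ (Ioi 0) x := fun n x hx => by
    have h := hφ.iteratedDerivWithin_nonneg (uniqueDiffOn_Ici 0) n (le_of_lt hx)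
    rwa [iteratedDerivWithin_eq_iteratedDeriv (uniqueDiffOn_Ici 0)
      (((hd.contDiffAt (Ioi_mem_nhds hx))).of_le (by exact_mod_cast le_top)) (le_of_lt hx),
      ← iteratedDerivWithin_of_isOpen isOpen_Ioi hx] at h
  obtain ⟨c, hc, hs⟩ := hd.isDerivSeq.exists_hasSum hnn
  simp only [iteratedDerivWithin_zero] at hs
  have key : ∀ x > 0, HasSum (fun k => c k * k.factorial * x⁻¹ ^ (k + 1)) (f x) := fun x hx => by
    obtain ⟨hint, hval⟩ := hf x hx
    set F : ℕ → ℝ → ℝ := fun k t => Real.exp (-x * t) * (c k * t ^ k)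
    have hF : ∀ k, IntegrableOn (F k) (Ioi 0) := fun k => integrableOn_exp_mul_pow hx _ k
    have hI : ∀ k, ∫ t in Ioi 0, F k t = c k * k.factorial * x⁻¹ ^ (k + 1) :=
      fun k => integral_exp_mul_pow hx _ k
    have hF0 : ∀ k, ∀ t ∈ Ioi (0 : ℝ), 0 ≤ F k t := fun k t ht =>
      mul_nonneg (Real.exp_pos _).le (mul_nonneg (hc k) (pow_nonneg (le_of_lt ht) k))
    have hN : ∀ k, ∫ t in Ioi 0, ‖F k t‖ = ∫ t in Ioi 0, F k t := fun k =>
      setIntegral_congr_fun measurableSet_Ioi fun t ht => Real.norm_of_nonneg (hF0 k t ht)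
    have hsum : ∀ t ∈ Ioi (0 : ℝ), HasSum (fun k => F k t) (Real.exp (-x * t) * φ t) :=
      fun t ht => (hs t ht).mul_left _
    have hS : Summable fun k => ∫ t in Ioi 0, ‖F k t‖ := by
      simp only [hN]
      -- Finite sums of the nonnegative terms stay below the integrand of f x, so their integrals
      -- stay below f x.
      refine summable_of_sum_le (c := f x)
        (fun k => setIntegral_nonneg measurableSet_Ioi (hF0 k)) fun u => ?_
      rw [hval, ← integral_finsetSum u fun k _ => hF k]
      exact setIntegral_mono_on (integrable_finsetSum u fun k _ => hF k) hint measurableSet_Ioi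
        fun t ht => sum_le_hasSum u (fun k _ => hF0 k t ht) (hsum t ht)
    have h := hasSum_integral_of_summable_integral_norm hF hS
    simp only [hI] at h
    rwa [hval, ← setIntegral_congr_fun measurableSet_Ioi fun t ht => (hsum t ht).tsum_eq]
  have key' : ∀ x > 0, HasSum (fun k => c k * k.factorial * x⁻¹ ^ k) (x * f x) := fun x hx => by
    refine ((key x hx).mul_left x).congr_fun fun k => ?_
    have : x ≠ 0 := ne_of_gt hx
    rw [pow_succ]
    field_simp
  refine ⟨fun k => c k * k.factorial, ⟨fun k => mul_nonneg (hc k) (by positivity), fun y hy => ?_⟩,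
    fun x hx => ?_⟩
  · simpa using (key' y⁻¹ (inv_pos.2 hy)).summable
  · rw [powerSum, (key' x hx).tsum_eq, inv_mul_cancel_left₀ (ne_of_gt hx)]

theorem IsInvPowerSeries.exists_expansion {f : ℝ → ℝ} (hf : IsInvPowerSeries f) :
    ∃ a : ℕ → ℝ, (∀ k, 0 ≤ a k) ∧
      ∀ n : ℕ, ∃ R : ℝ → ℝ, CompletelyMonotonicOfOrder n R ∧
        ∀ x > 0, f x = (∑ k ∈ Finset.Icc 1 n, a k / x ^ k) + R x := by
  obtain ⟨b, hb, hfb⟩ := hf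
  refine ⟨shiftCoeff b, hb.shift.1, fun n =>
    -- The tail of the series; times x^n it is again a nonnegative power series in 1/x.
    ⟨fun x => x⁻¹ ^ (n + 1) * powerSum (fun k => b (k + n)) x⁻¹, ?_, fun x hx => ?_⟩⟩
  · refine (hb.add_right n).shift.completelyMonotonic_inv.congr fun x hx => ?_
    have : x ≠ 0 := ne_of_gt hx
    simp only [Real.rpow_natCast]
    rw [(hb.add_right n).powerSum_shiftCoeff, pow_succ, ← mul_assoc, ← mul_assoc, ← mul_pow,
      mul_inv_cancel₀ this, one_pow, one_mul]
  · induction n with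
    | zero => simpa using hfb x hx
    | succ n ih =>
      beta_reduce at ih ⊢
      rw [ih, (hb.add_right n).powerSum_eq_add, Finset.sum_Icc_succ_top (by omega)]
      simp only [shiftCoeff, zero_add, add_assoc, add_comm 1 n, div_eq_mul_inv, inv_pow]
      ring

theorem isInvPowerSeries_of_nonneg {f : ℝ → ℝ}
    (h : ∀ k : ℕ, TimesDifferentiableOn k (fun x => x ^ k * f x) (Ioi 0) ∧
      ∀ x > 0, 0 ≤ (-1) ^ k * iteratedDerivWithin k (fun t => t ^ k * f t) (Ioi 0) x) :
    IsInvPowerSeries f := by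
  have hf := contDiffOn_of_timesDifferentiableOn_pow_mul fun k => (h k).1
  have hF : ∀ k : ℕ, ContDiffOn ℝ ∞ (fun x => x ^ k * f x) (Ioi 0) :=
    fun k => (contDiff_id.pow k).contDiffOn.mul hf
  set g : ℕ → ℝ → ℝ := fun k x =>
    (-1) ^ k * iteratedDerivWithin k (fun t => t ^ k * f t) (Ioi 0) x
  -- Leibniz's rule for x · x^k f. In `hD` the term (k + 1) g k cancels against the derivative of
  -- y^(-k-1).
  have hg : ∀ k, ∀ x > 0, HasDerivAt (g k) (-(g (k + 1) x + (k + 1) * g k x) / x) x :=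
    fun k x hx => by
      refine (((hF k).isDerivSeq k x hx).const_mul ((-1) ^ k)).congr_deriv ?_
      have h1 := iteratedDerivWithin_succ_id_mul (hF k) k hx
      simp only [← mul_assoc, ← pow_succ'] at h1
      simp only [g, h1]
      field_simp
      ring
  have hD : IsDerivSeq fun k y => y⁻¹ ^ (k + 1) * g k y⁻¹ := fun k y hy => by
    refine (((hasDerivAt_inv hy.ne').pow (k + 1)).mul
      ((hg k y⁻¹ (inv_pos.2 hy)).comp y (hasDerivAt_inv hy.ne'))).congr_deriv ?_
    simp only [Nat.add_sub_cancel, Pi.pow_apply, Function.comp_apply]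
    obtain ⟨z, rfl⟩ : ∃ z, y = z⁻¹ := ⟨y⁻¹, (inv_inv y).symm⟩
    have hz : z ≠ 0 := (inv_pos.1 hy).ne'
    push_cast
    simp only [inv_inv]
    field_simp
    ring
  obtain ⟨b, hb, hs⟩ := hD.exists_hasSum fun k y hy =>
    mul_nonneg (pow_nonneg (inv_nonneg.2 (le_of_lt hy)) _) ((h k).2 _ (inv_pos.2 hy))
  refine ⟨b, ⟨hb, fun y hy => (hs y hy).summable⟩, fun x hx => ?_⟩
  rw [powerSum, (hs x⁻¹ (inv_pos.2 hx)).tsum_eq]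
  simp only [g]
  have : x ≠ 0 := ne_of_gt hx
  simp [this]

theorem nonneg_of_iteratedDeriv_two_mul_sub_one {f : ℝ → ℝ} (hf0 : ∀ x > 0, 0 ≤ f x)
    (h : ∀ k : ℕ, 1 ≤ k → TimesDifferentiableOn (2 * k - 1) (fun x => x ^ k * f x) (Ioi 0) ∧
      ∀ x > 0, iteratedDerivWithin (2 * k - 1) (fun t => t ^ k * f t) (Ioi 0) x ≤ 0) (k : ℕ) :
    TimesDifferentiableOn k (fun x => x ^ k * f x) (Ioi 0) ∧
      ∀ x > 0, 0 ≤ (-1) ^ k * iteratedDerivWithin k (fun t => t ^ k * f t) (Ioi 0) x := by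
  have ht : ∀ k : ℕ, TimesDifferentiableOn k (fun x => x ^ k * f x) (Ioi 0) := fun k => by
    cases k with
    | zero => exact fun j hj => absurd hj (Nat.not_lt_zero j)
    | succ k => exact (h (k + 1) (by omega)).1.mono (by omega)
  have hf := contDiffOn_of_timesDifferentiableOn_pow_mul ht
  refine ⟨ht k, ?_⟩
  cases k with
  | zero => simpa using hf0
  | succ m =>
    have hF : ∀ k : ℕ, ContDiffOn ℝ ∞ (fun x => x ^ k * f x) (Ioi 0) :=
      fun k => (contDiff_id.pow k).contDiffOn.mul hf
    have hanti : AntitoneOn (fun x => x ^ 1 * f x) (Ioi 0) :=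
      antitoneOn_of_hasDerivWithinAt_nonpos (convex_Ioi 0) (hF 1).continuousOn
        (fun x hx => by
          have := ((hF 1).isDerivSeq 0 x (by simpa using hx)).hasDerivWithinAt (s := interior (Ioi 0))
          beta_reduce at this
          rwa [iteratedDerivWithin_zero] at this)
        (fun x hx => (h 1 le_rfl).2 x (by simpa using hx))
    have hC : ∀ x ≥ 1, |x ^ (m + 1) * f x| ≤ f 1 * x ^ m := fun x hx => by
      have hx0 : 0 < x := one_pos.trans_le hx
      have h1 := hanti (mem_Ioi.2 one_pos) (mem_Ioi.2 hx0) hx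
      simp only [pow_one, one_mul] at h1
      rw [abs_of_nonneg (mul_nonneg (by positivity) (hf0 x hx0)), pow_succ, mul_assoc, mul_comm]
      gcongr
    have hstep : ∀ d : ℕ, (∀ x > 0, 0 ≤ (-1) ^ (m + d + 1) *
        iteratedDerivWithin (m + d + 1) (fun t => t ^ (m + 1) * f t) (Ioi 0) x) →
        ∀ x > 0, 0 ≤ (-1) ^ (m + 1) *
          iteratedDerivWithin (m + 1) (fun t => t ^ (m + 1) * f t) (Ioi 0) x := fun d => by
      induction d with
      | zero => exact id
      | succ d ih =>
        exact fun hd => ih ((hF (m + 1)).isDerivSeq.nonneg_of_le_pow (m := m) (n := m + d)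
          (by omega) (by simpa using hC) hd)
    -- With k = m + 1 the descent starts at 2k - 1 = m + m + 1, an odd order, and makes m steps down
    -- to k.
    refine hstep m fun x hx => ?_
    have h1 := (h (m + 1) (by omega)).2 x hx
    rw [show 2 * (m + 1) - 1 = m + m + 1 by omega] at h1
    rw [(show Odd (m + m + 1) from ⟨m, by ring⟩).neg_one_pow]
    linarith

end

theorem theorem1 (f : ℝ → ℝ) :
    List.TFAE [
      -- (i)
      ∃ φ : ℝ → ℝ, AbsolutelyMonotoneOn φ (Ici 0) ∧ IsLaplaceTransform f φ,
      -- (ii)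
      ∃ a : ℕ → ℝ, (∀ k, 0 ≤ a k) ∧
        ∀ n : ℕ, ∃ R : ℝ → ℝ, CompletelyMonotonicOfOrder n R ∧
          ∀ x > 0, f x = (∑ k ∈ Finset.Icc 1 n, a k / x ^ k) + R x,
      -- (iii)
      ∀ k : ℕ, TimesDifferentiableOn k (fun x => x ^ k * f x) (Ioi 0) ∧
        CompletelyMonotonic
          (fun x => (-1) ^ k * iteratedDerivWithin k (fun t => t ^ k * f t) (Ioi 0) x),
      -- (iv)
      ∀ k : ℕ, TimesDifferentiableOn k (fun x => x ^ k * f x) (Ioi 0) ∧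
        ∀ x > 0, 0 ≤ (-1) ^ k * iteratedDerivWithin k (fun t => t ^ k * f t) (Ioi 0) x,
      -- (v)
      (∀ x > 0, 0 ≤ f x) ∧
        ∀ k : ℕ, 1 ≤ k →
          TimesDifferentiableOn (2 * k - 1) (fun x => x ^ k * f x) (Ioi 0) ∧
          ∀ x > 0, iteratedDerivWithin (2 * k - 1) (fun t => t ^ k * f t) (Ioi 0) x ≤ 0
    ] := by
  tfae_have 1 → 2 := fun ⟨φ, hφ, hf⟩ => (hf.isInvPowerSeries hφ).exists_expansion
  tfae_have 2 → 3 := fun ⟨a, _, h⟩ k => by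
    obtain ⟨hd, G, hG, he⟩ := iteratedDerivWithin_pow_mul_of_expansion h k
    exact ⟨hd.timesDifferentiableOn (uniqueDiffOn_Ioi 0) k, (hG.iteratedDerivWithin k).congr
      fun x hx => by rw [he k le_rfl hx]⟩
  tfae_have 3 → 4 := fun h k => ⟨(h k).1, fun x hx => by simpa using (h k).2.2 0 x hx⟩
  tfae_have 4 → 1 := fun h => (isInvPowerSeries_of_nonneg h).exists_isLaplaceTransform
  tfae_have 2 → 5 := fun ⟨a, _, h⟩ => by
    refine ⟨fun x hx => ?_, fun k hk => ?_⟩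
    · obtain ⟨-, G, hG, he⟩ := iteratedDerivWithin_pow_mul_of_expansion h 0
      have h0 := hG.2 0 x hx
      rw [← he 0 le_rfl hx] at h0
      simpa using h0
    · obtain ⟨hd, G, hG, he⟩ := iteratedDerivWithin_pow_mul_of_expansion h k
      refine ⟨hd.timesDifferentiableOn (uniqueDiffOn_Ioi 0) _, fun x hx => ?_⟩
      have h0 := hG.2 (2 * k - 1) x hx
      rw [← he (2 * k - 1) (by omega) hx,
        (show Odd (2 * k - 1) from ⟨k - 1, by omega⟩).neg_one_pow] at h0
      linarith
  tfae_have 5 → 4 := fun ⟨h0, h⟩ => nonneg_of_iteratedDeriv_two_mul_sub_one h0 h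
  tfae_finish
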